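/- Let $n\ge 2$ and let $G\subset\mathbb{C}^n$ be a smoothly bounded pseudoconvex domain. Then the boundary $\partial G$ is connected. Here a \emph{smoothly bounded domain} is a nonempty, bounded, connected open set $G$ such that every $p\in\partial G$ has an open neighborhood $U$ and a $C^\infty$ function $\rho\colon U\to\mathbb{R}$ with $d\rho\neq 0$ on $U$ and $G\cap U=\{z\in U:\rho(z)<0\}$; and $G$ is \emph{pseudoconvex} if there is a continuous plurisubharmonic function $\varphi\colon G\to\mathbb{R}$ all of whose sublevel sets $\{z\in G:\varphi(z)\le c\}$, $c\in\mathbb{R}$, are compact. -/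

import Mathlib

open scoped ContDiff

/-- A domain in `ℂⁿ`: a nonempty connected open set. -/
def IsDomainCn {n : ℕ} (G : Set (EuclideanSpace ℂ (Fin n))) : Prop :=
  IsOpen G ∧ IsConnected G

/-- `G` has smooth boundary: near each boundary point there is a `C^∞` real-valued function `ρ` with
nowhere vanishing differential such that `G` is locally the set `{ρ < 0}`. -/
def HasSmoothBoundary {n : ℕ} (G : Set (EuclideanSpace ℂ (Fin n))) : Prop :=
  ∀ p ∈ frontier G, ∃ (U : Set (EuclideanSpace ℂ (Fin n))) (ρ : EuclideanSpace ℂ (Fin n) → ℝ),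
    IsOpen U ∧ p ∈ U ∧ ContDiffOn ℝ ∞ ρ U ∧ (∀ z ∈ U, fderiv ℝ ρ z ≠ 0) ∧
      G ∩ U = {z ∈ U | ρ z < 0}

/-- A smoothly bounded domain: a bounded domain with smooth boundary. -/
def IsSmoothlyBoundedDomain {n : ℕ} (G : Set (EuclideanSpace ℂ (Fin n))) : Prop :=
  IsDomainCn G ∧ Bornology.IsBounded G ∧ HasSmoothBoundary G

/-- `φ` is a continuous plurisubharmonic function on (the open set) `G`: it is continuous on `G` and
satisfies the sub-mean value inequality on every closed disc `{a + ζ w : |ζ| ≤ 1}`, in a complex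
line, that is contained in `G`. -/
def IsContinuousPSHOn {n : ℕ} (φ : EuclideanSpace ℂ (Fin n) → ℝ)
    (G : Set (EuclideanSpace ℂ (Fin n))) : Prop :=
  ContinuousOn φ G ∧
    ∀ a w : EuclideanSpace ℂ (Fin n), (∀ ζ : ℂ, ‖ζ‖ ≤ 1 → a + ζ • w ∈ G) →
      φ a ≤ Real.circleAverage (fun ζ : ℂ => φ (a + ζ • w)) 0 1

/-- `G` is pseudoconvex: it is open and has a continuous plurisubharmonic exhaustion function, i.e.
one whose sublevel sets `{z ∈ G : φ z ≤ c}` are all compact. -/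
def IsPseudoconvex {n : ℕ} (G : Set (EuclideanSpace ℂ (Fin n))) : Prop :=
  IsOpen G ∧ ∃ φ : EuclideanSpace ℂ (Fin n) → ℝ,
    IsContinuousPSHOn φ G ∧ ∀ c : ℝ, IsCompact {z ∈ G | φ z ≤ c}

/-!
Since `G` is open, `frontier G = closure G ∩ Gᶜ`, and these two closed sets cover `ℂⁿ`. The space
`ℂⁿ` is unicoherent (`IsPreconnected.inter_of_isClosed_of_union_eq_univ`): two closed connected sets
which cover it have a connected intersection, since a separation of the intersection gives a map
to the circle which has no continuous logarithm. So it is enough to know that `Gᶜ` is connected.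

If `Gᶜ` is not connected, then, the exterior of a large ball being connected, one of the pieces of
`Gᶜ` is a nonempty compact set `K` such that `G ∪ K` is open. This is a Hartogs hole, and
pseudoconvexity excludes it (`IsPseudoconvex.compact_eq_empty_of_isOpen_union`): fix `x₀ ∈ G` and let
`p` be a point of `K` at the largest distance from `x₀`. As `n ≥ 2`, there is a small disc through
`p` in a complex line orthogonal to `p - x₀`; all of its points other than `p` are farther from `x₀`
than `p`, so they lie in `G`, and so do all points of its translates by `t (p - x₀)`, `t > 0`. The
boundary circles of these discs stay in a compact subset of `G`, so the exhaustion function is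
bounded on them, hence also at the centres, although these tend to `p ∉ G`.
-/

/-! ### Unicoherence of simply connected spaces -/

/-- Simply connected normal spaces are unicoherent: closed preconnected sets that cover the space
have a preconnected intersection. -/
theorem IsPreconnected.inter_of_isClosed_of_union_eq_univ {X : Type*} [TopologicalSpace X]
    [NormalSpace X] [SimplyConnectedSpace X] [LocallyPathConnectedSpace X] {A B : Set X}
    (hA : IsPreconnected A) (hB : IsPreconnected B) (hAc : IsClosed A) (hBc : IsClosed B)
    (hAB : A ∪ B = Set.univ) : IsPreconnected (A ∩ B) := by
  classical
  rw [isPreconnected_closed_iff]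
  rintro t t' ht ht' hsub ⟨p, hpAB, hpt⟩ ⟨q, hqAB, hqt⟩
  by_contra hne
  rw [Set.not_nonempty_iff_eq_empty] at hne
  have hdisj : Disjoint (A ∩ B ∩ t) (A ∩ B ∩ t') := by
    rw [Set.disjoint_left]
    rintro x ⟨hx, hxt⟩ ⟨-, hxt'⟩
    exact Set.eq_empty_iff_forall_notMem.1 hne x ⟨hx, hxt, hxt'⟩
  obtain ⟨u, hu0, hu1, -⟩ := exists_continuous_zero_one_of_isClosed
    ((hAc.inter hBc).inter ht) ((hAc.inter hBc).inter ht') hdisj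
  -- The two definitions agree on `A ∩ B`, where `u` is `0` or `1`.
  let f : X → Circle := fun x ↦
    if x ∈ A then Circle.exp (Real.pi * u x) else Circle.exp (-(Real.pi * u x))
  have hfA : Set.EqOn f (fun x ↦ Circle.exp (Real.pi * u x)) A := fun x hx ↦ if_pos hx
  have hfB : Set.EqOn f (fun x ↦ Circle.exp (-(Real.pi * u x))) B := by
    intro x hxB
    by_cases hxA : x ∈ A
    · rw [hfA hxA]
      rcases hsub ⟨hxA, hxB⟩ with h | h
      · simp [hu0 ⟨⟨hxA, hxB⟩, h⟩]
      · simp [hu1 ⟨⟨hxA, hxB⟩, h⟩, Circle.ext_iff]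
    · exact if_neg hxA
  have hf : Continuous f := by
    rw [← continuousOn_univ, ← hAB]
    refine ContinuousOn.union_of_isClosed ?_ ?_ hAc hBc
    · exact ContinuousOn.congr (by fun_prop) hfA
    · exact ContinuousOn.congr (by fun_prop) hfB
  have hup : u p = 0 := hu0 ⟨hpAB, hpt⟩
  have huq : u q = 1 := hu1 ⟨hqAB, hqt⟩
  obtain ⟨g, ⟨hgp, hg⟩, -⟩ := Circle.isCoveringMap_exp.existsUnique_continuousMap_lifts
    ⟨f, hf⟩ p 0 (by simp [hfA hpAB.1, hup])
  -- The lift `g` is `π u` on `A` and `-π u` on `B`, since this holds at `p`.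
  have hgA : Set.EqOn g (fun x ↦ Real.pi * u x) A :=
    Circle.isCoveringMap_exp.eqOn_of_comp_eqOn hA (by fun_prop) (by fun_prop)
      (fun x hx ↦ (congrFun hg x).trans (hfA hx)) hpAB.1 (by simp [hgp, hup])
  have hgB : Set.EqOn g (fun x ↦ -(Real.pi * u x)) B :=
    Circle.isCoveringMap_exp.eqOn_of_comp_eqOn hB (by fun_prop) (by fun_prop)
      (fun x hx ↦ (congrFun hg x).trans (hfB hx)) hpAB.2 (by simp [hgp, hup])
  have h := (hgA hqAB.1).symm.trans (hgB hqAB.2)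
  simp only [huq, mul_one] at h
  linarith [Real.pi_pos]

/-! ### Pseudoconvex sets have no compact holes -/

theorem exists_ne_zero_inner_eq_zero {n : ℕ} (hn : 2 ≤ n) (v : EuclideanSpace ℂ (Fin n)) :
    ∃ w : EuclideanSpace ℂ (Fin n), w ≠ 0 ∧ inner ℂ v w = 0 := by
  have h : (Submodule.span ℂ {v})ᗮ ≠ ⊥ := by
    rw [Ne, Submodule.orthogonal_eq_bot_iff]
    intro h
    have h1 := finrank_span_le_card (R := ℂ) {v}
    rw [h, finrank_top, finrank_euclideanSpace_fin, Set.toFinset_singleton,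
      Finset.card_singleton] at h1
    omega
  obtain ⟨w, hw, hw0⟩ := Submodule.exists_mem_ne_zero_of_ne_bot h
  exact ⟨w, hw0, Submodule.mem_orthogonal_singleton_iff_inner_right.1 hw⟩

/-- A form of the Hartogs phenomenon: a nonempty pseudoconvex set in dimension at least two cannot
be enlarged to an open set by adding a nonempty compact set. -/
theorem IsPseudoconvex.compact_eq_empty_of_isOpen_union {n : ℕ} (hn : 2 ≤ n)
    {G K : Set (EuclideanSpace ℂ (Fin n))} (hG : IsPseudoconvex G) (hne : G.Nonempty)
    (hK : IsCompact K) (hdisj : Disjoint G K) (hopen : IsOpen (G ∪ K)) : K = ∅ := by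
  obtain ⟨-, φ, ⟨hφc, hφ⟩, hcpt⟩ := hG
  obtain ⟨x₀, hx₀⟩ := hne
  by_contra hKne
  obtain ⟨p, hpK, hpmax⟩ := hK.exists_isMaxOn (Set.nonempty_iff_ne_empty.2 hKne)
    (f := fun z ↦ ‖z - x₀‖) (by fun_prop)
  have hpG : p ∉ G := fun h ↦ Set.disjoint_left.1 hdisj h hpK
  obtain ⟨δ, hδ, hball⟩ := Metric.nhds_basis_closedBall.mem_iff.1
    (hopen.mem_nhds (Or.inr hpK : p ∈ G ∪ K))
  set v := p - x₀ with hv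
  have hv0 : 0 < ‖v‖ := by
    rw [norm_pos_iff, hv, sub_ne_zero]
    rintro rfl
    exact hpG hx₀
  obtain ⟨w, hw, hvw⟩ : ∃ w : EuclideanSpace ℂ (Fin n), ‖w‖ = δ / 2 ∧ inner ℂ v w = 0 := by
    obtain ⟨w, hw0, hvw⟩ := exists_ne_zero_inner_eq_zero hn v
    refine ⟨(((δ / 2 / ‖w‖ : ℝ)) : ℂ) • w, ?_, by rw [inner_smul_right, hvw, mul_zero]⟩
    have := norm_pos_iff.2 hw0
    rw [norm_smul, Complex.norm_real, Real.norm_of_nonneg (by positivity)]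
    field_simp
  -- For `0 ≤ t ≤ t₀` the discs `p + t v + ζ w` stay in the ball of radius `δ` about `p`.
  set t₀ := δ / 2 / ‖v‖ with ht₀
  have ht₀pos : 0 < t₀ := by positivity
  have hmem : ∀ t : ℝ, 0 ≤ t → t ≤ t₀ → ∀ ζ : ℂ, ‖ζ‖ ≤ 1 → (0 < t ∨ ζ ≠ 0) →
      p + (t : ℂ) • v + ζ • w ∈ G := by
    intro t ht htt ζ hζ hor
    have hin : p + (t : ℂ) • v + ζ • w ∈ G ∪ K := by
      apply hball
      rw [mem_closedBall_iff_norm, add_assoc, add_sub_cancel_left]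
      refine (norm_add_le _ _).trans ?_
      rw [norm_smul, norm_smul, Complex.norm_real, Real.norm_of_nonneg ht, hw]
      have h1 : t * ‖v‖ ≤ δ / 2 := by rwa [ht₀, le_div_iff₀ hv0] at htt
      nlinarith
    refine hin.resolve_right fun hmK ↦ ?_
    have hle : ‖p + (t : ℂ) • v + ζ • w - x₀‖ ≤ ‖v‖ := hpmax hmK
    -- Pythagoras: relative to `x₀` the point is `(1 + t) v + ζ w` with `w ⊥ v`, so it is farther
    -- away than `p`, the farthest point of `K`.
    have heq : p + (t : ℂ) • v + ζ • w - x₀ = ((1 + t : ℝ) : ℂ) • v + ζ • w := by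
      rw [hv]; push_cast; module
    have hpyth := norm_add_sq_eq_norm_sq_add_norm_sq_of_inner_eq_zero
      (((1 + t : ℝ) : ℂ) • v) (ζ • w) (by rw [inner_smul_left, inner_smul_right, hvw]; simp)
    rw [heq] at hle
    have h2 : ‖((1 + t : ℝ) : ℂ) • v‖ = (1 + t) * ‖v‖ := by
      rw [norm_smul, Complex.norm_real, Real.norm_of_nonneg (by positivity)]
    have h3 : ‖ζ • w‖ = ‖ζ‖ * (δ / 2) := by rw [norm_smul, hw]
    rw [h2, h3] at hpyth
    have h4 := mul_self_le_mul_self (norm_nonneg _) hle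
    rw [hpyth] at h4
    have h5 : 0 ≤ t * (‖v‖ * ‖v‖) := by positivity
    have h6 : 0 ≤ t * t * (‖v‖ * ‖v‖) := by positivity
    have h7 : 0 ≤ ‖ζ‖ * (δ / 2) * (‖ζ‖ * (δ / 2)) := by positivity
    rcases hor with h | h
    · have : 0 < t * (‖v‖ * ‖v‖) := by positivity
      nlinarith
    · have := norm_pos_iff.2 h
      have : 0 < ‖ζ‖ * (δ / 2) * (‖ζ‖ * (δ / 2)) := by positivity
      nlinarith
  have hcirc : ∀ t ∈ Set.Icc 0 t₀, ∀ ζ ∈ Metric.sphere (0 : ℂ) 1,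
      p + (t : ℂ) • v + ζ • w ∈ G := by
    intro t ht ζ hζ
    rw [mem_sphere_zero_iff_norm] at hζ
    exact hmem t ht.1 ht.2 ζ hζ.le (Or.inr (norm_pos_iff.1 (hζ ▸ one_pos)))
  obtain ⟨M, hM⟩ : ∃ M, ∀ t ∈ Set.Icc 0 t₀, ∀ ζ ∈ Metric.sphere (0 : ℂ) 1,
      φ (p + (t : ℂ) • v + ζ • w) ≤ M := by
    have hc : ContinuousOn (fun x : ℝ × ℂ ↦ φ (p + (x.1 : ℂ) • v + x.2 • w))
        (Set.Icc 0 t₀ ×ˢ Metric.sphere (0 : ℂ) 1) :=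
      hφc.comp (by fun_prop) fun x hx ↦ hcirc x.1 hx.1 x.2 hx.2
    obtain ⟨M, hM⟩ := (isCompact_Icc.prod (isCompact_sphere (0 : ℂ) 1)).bddAbove_image hc
    exact ⟨M, fun t ht ζ hζ ↦ hM ⟨(t, ζ), ⟨ht, hζ⟩, rfl⟩⟩
  have hcentre : ∀ t ∈ Set.Ioc 0 t₀, p + (t : ℂ) • v ∈ {z ∈ G | φ z ≤ M} := by
    intro t ht
    have hdisc : ∀ ζ : ℂ, ‖ζ‖ ≤ 1 → p + (t : ℂ) • v + ζ • w ∈ G := fun ζ hζ ↦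
      hmem t ht.1.le ht.2 ζ hζ (Or.inl ht.1)
    refine ⟨by simpa using hdisc 0 (by simp), (hφ _ w hdisc).trans ?_⟩
    have ht' : t ∈ Set.Icc 0 t₀ := ⟨ht.1.le, ht.2⟩
    refine Real.circleAverage_mono_on_of_le_circle
      (ContinuousOn.circleIntegrable zero_le_one (hφc.comp (by fun_prop) (hcirc t ht'))) ?_
    rw [abs_one]
    exact hM t ht'
  have hlim : Filter.Tendsto (fun t : ℝ ↦ p + (t : ℂ) • v) (nhdsWithin 0 (Set.Ioi 0)) (nhds p) := by
    have : Continuous fun t : ℝ ↦ p + (t : ℂ) • v := by fun_prop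
    simpa using (this.tendsto 0).mono_left nhdsWithin_le_nhds
  exact hpG ((hcpt M).isClosed.mem_of_tendsto hlim
    (Filter.eventually_of_mem (Ioc_mem_nhdsGT ht₀pos) hcentre)).1

/-! ### Connectedness of the complement and of the boundary -/

/-- The set is the image of `[r, ∞) × S` under scaling, where `S` is the unit sphere. -/
theorem isPreconnected_setOf_le_norm {E : Type*} [NormedAddCommGroup E] [NormedSpace ℝ E]
    (h : 1 < Module.rank ℝ E) {r : ℝ} (hr : 0 < r) : IsPreconnected {z : E | r ≤ ‖z‖} := by
  have himage : {z : E | r ≤ ‖z‖} =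
      (fun x : ℝ × E ↦ x.1 • x.2) '' (Set.Ici r ×ˢ Metric.sphere (0 : E) 1) := by
    ext z
    constructor
    · intro hz
      have hz0 : 0 < ‖z‖ := hr.trans_le hz
      refine ⟨(‖z‖, ‖z‖⁻¹ • z), ⟨hz, ?_⟩, ?_⟩
      · simp [norm_smul, hz0.ne']
      · simp [smul_smul, hz0.ne']
    · rintro ⟨⟨t, y⟩, ⟨ht, hy⟩, rfl⟩
      rw [mem_sphere_zero_iff_norm] at hy
      simp only [Set.mem_Ici] at ht
      simpa [norm_smul, hy, abs_of_pos (hr.trans_le ht)] using ht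
  rw [himage]
  exact (isPreconnected_Ici.prod (isPreconnected_sphere h 0 1)).image _ (by fun_prop)

theorem IsPseudoconvex.isPreconnected_compl {n : ℕ} (hn : 2 ≤ n)
    {G : Set (EuclideanSpace ℂ (Fin n))} (hG : IsPseudoconvex G) (hne : G.Nonempty)
    (hbdd : Bornology.IsBounded G) : IsPreconnected Gᶜ := by
  rw [isPreconnected_closed_iff]
  intro t t' ht ht' hsub hnt hnt'
  by_contra hempty
  rw [Set.not_nonempty_iff_eq_empty] at hempty
  obtain ⟨r, hr, hball⟩ := hbdd.subset_ball_lt 0 0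
  have hGc : IsClosed Gᶜ := hG.1.isClosed_compl
  have hext : {z : EuclideanSpace ℂ (Fin n) | r ≤ ‖z‖} ⊆ Gᶜ := fun z hz hzG ↦
    (mem_ball_zero_iff.1 (hball hzG)).not_ge hz
  -- The piece of `Gᶜ` that does not contain the exterior of the ball is a compact hole, so it is
  -- empty.
  have key : ∀ s s' : Set (EuclideanSpace ℂ (Fin n)), IsClosed s → IsClosed s' → Gᶜ ⊆ s ∪ s' →
      Gᶜ ∩ (s ∩ s') = ∅ → {z : EuclideanSpace ℂ (Fin n) | r ≤ ‖z‖} ⊆ s' → Gᶜ ∩ s = ∅ := by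
    intro s s' hs hs' hss hse hes
    have hdis : ∀ z ∈ Gᶜ, z ∈ s → z ∉ s' := fun z hz h h' ↦
      Set.eq_empty_iff_forall_notMem.1 hse z ⟨hz, h, h'⟩
    refine hG.compact_eq_empty_of_isOpen_union hn hne ?_ ?_ ?_
    · refine (isCompact_closedBall (0 : EuclideanSpace ℂ (Fin n)) r).of_isClosed_subset
        (hGc.inter hs) fun z hz ↦ ?_
      rw [mem_closedBall_zero_iff]
      by_contra! hlt
      exact hdis z hz.1 hz.2 (hes hlt.le)
    · exact Set.disjoint_left.2 fun z hz hz' ↦ hz'.1 hz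
    · have : G ∪ Gᶜ ∩ s = (Gᶜ ∩ s')ᶜ := by
        ext z
        have h1 := @hss z
        have h2 := hdis z
        simp only [Set.mem_union, Set.mem_inter_iff, Set.mem_compl_iff] at *
        tauto
      rw [this]
      exact (hGc.inter hs').isOpen_compl
  have hrank : 1 < Module.rank ℝ (EuclideanSpace ℂ (Fin n)) := by
    apply Module.one_lt_rank_of_one_lt_finrank
    rw [← Module.finrank_mul_finrank ℝ ℂ, Complex.finrank_real_complex,
      finrank_euclideanSpace_fin]
    omega
  rcases isPreconnected_iff_subset_of_disjoint_closed.1 (isPreconnected_setOf_le_norm hrank hr)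
    t t' ht ht' (hext.trans hsub)
    (Set.subset_empty_iff.1 ((Set.inter_subset_inter_left _ hext).trans hempty.le)) with h | h
  · exact hnt'.ne_empty (key t' t ht' ht (by rwa [Set.union_comm])
      (by rwa [Set.inter_comm t']) h)
  · exact hnt.ne_empty (key t t' ht ht' hsub hempty h)

theorem mainTheorem9 (n : ℕ) (hn : 2 ≤ n) (G : Set (EuclideanSpace ℂ (Fin n)))
    (hG : IsSmoothlyBoundedDomain G) (hpsc : IsPseudoconvex G) :
    IsConnected (frontier G) := by
  obtain ⟨⟨hopen, hconn⟩, hbdd, -⟩ := hG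
  constructor
  · rw [nonempty_frontier_iff]
    refine ⟨hconn.nonempty, ?_⟩
    rintro rfl
    have : NeZero n := ⟨by omega⟩
    exact NormedSpace.unbounded_univ ℂ _ hbdd
  · have hfr : frontier G = closure G ∩ Gᶜ := by rw [hopen.frontier_eq, Set.sdiff_eq]
    rw [hfr]
    refine hconn.isPreconnected.closure.inter_of_isClosed_of_union_eq_univ
      (hpsc.isPreconnected_compl hn hconn.nonempty hbdd) isClosed_closure hopen.isClosed_compl ?_
    exact Set.eq_univ_of_subset (Set.union_subset_union_left _ subset_closure)
      (Set.union_compl_self G)
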